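/- Let $M=(x_{ij})$ be the generic skew-symmetric $5\times5$ matrix in the ten coordinates $x_{ij}$ ($1\le i<j\le 5$) of $\mathbb{C}^{10}$, and let $\mathrm{CGr}(2,5)\subset\mathbb{C}^{10}$ be the affine cone over the Plücker-embedded Grassmannian, of codimension $3$, defined by the five maximal ($4\times4$) Pfaffians of $M$. Let $\chi=(\chi_{ij})_{i<j}$ be integers (of any sign, called key weights) such that the five Pfaffians are homogeneous when $\deg x_{ij}=\chi_{ij}$. Let $d\ge 0$, let $R=\mathbb{C}[y_1,\dots,y_{d+4}]$ be graded by strictly positive integer weights $W=(w_1,\dots,w_{d+4})$, and let $\phi\colon\operatorname{Spec}R\to\mathbb{C}^{10}$ be a morphism that is graded of degree zero with respect to $\chi$ and $W$. Suppose that $\phi^{-1}(\mathrm{CGr}(2,5))\subset\operatorname{Spec}R$ contains the origin $O$ and has codimension $3$, and that the pullback by $\phi$ of the Pfaffian free resolution of $\mathrm{CGr}(2,5)$ is minimal (equivalently, no entry of the pulled-back matrix $\phi^*M$ is a nonzero constant). Then the $d$-dimensional $$X=\bigl(\phi^{-1}(\mathrm{CGr}(2,5))\setminus O\bigr)/\mathbb{C}^*\subset\mathbb{P}(W)$$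 is said to be a variety in $\mathrm{CGr}(2,5)$ format with key weights $\chi$; it is called quasismooth if the affine scheme $\phi^{-1}(\mathrm{CGr}(2,5))$, defined by the pulled-back Pfaffians, is nonsingular away from $O$. Proposition. Let $X$ be a variety in $\mathrm{CGr}(2,5)$ format with key weights $\chi$. If $X$ is quasismooth and $\dim X=d\ge 3$, then every key weight $\chi_{ij}$ is strictly positive. -/

import Mathlib

namespace GrFormat

/-- Index set of the ten coordinates `x_{ij}`, `i < j`, of `ℂ¹⁰ = ⋀² ℂ⁵`. -/
abbrev PluckerIndex : Type := {p : Fin 5 × Fin 5 // p.1 < p.2}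

/-- The coordinate ring `ℂ[x_{ij}]` of the ambient space `ℂ¹⁰` of the key variety. -/
abbrev KeyRing : Type := MvPolynomial PluckerIndex ℂ

/-- The generic skew-symmetric `5 × 5` matrix, with entries `x_{ij}` above the diagonal. -/
noncomputable def genericSkew : Matrix (Fin 5) (Fin 5) KeyRing := fun i j =>
  if h : i < j then MvPolynomial.X ⟨(i, j), h⟩
  else if h : j < i then -MvPolynomial.X ⟨(j, i), h⟩
  else 0

/-- The `m`-th maximal Pfaffian of the generic skew matrix: the Pfaffian of the `4 × 4` skew matrix
obtained by deleting row and column `m`. -/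
noncomputable def pfaffian (m : Fin 5) : KeyRing :=
  genericSkew (m.succAbove 0) (m.succAbove 1) * genericSkew (m.succAbove 2) (m.succAbove 3)
    - genericSkew (m.succAbove 0) (m.succAbove 2) * genericSkew (m.succAbove 1) (m.succAbove 3)
    + genericSkew (m.succAbove 0) (m.succAbove 3) * genericSkew (m.succAbove 1) (m.succAbove 2)

/-- The ideal of the affine cone `CGr(2,5) ⊆ ℂ¹⁰` in its Plücker embedding. -/
noncomputable def keyIdeal : Ideal KeyRing := Ideal.span (Set.range pfaffian)

/-- `χ` is a system of integral weights on `ℂ¹⁰` (of any sign) for which the equations of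
`CGr(2,5)` are homogeneous. -/
def IsKeyWeight (χ : PluckerIndex → ℤ) : Prop :=
  ∀ m : Fin 5, ∃ e : ℤ, MvPolynomial.IsWeightedHomogeneous χ (pfaffian m) e

/-- First map of the Pfaffian resolution `0 → A → A⁵ → A⁵ → A` of `A ⧸ keyIdeal`, `A = ℂ[x_{ij}]`:
the row of signed Pfaffians. -/
noncomputable def resolutionFst : Matrix (Fin 1) (Fin 5) KeyRing :=
  fun _ m => (-1) ^ (m : ℕ) * pfaffian m

/-- Second map of the Pfaffian resolution (the first syzygies): the skew matrix itself. -/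
noncomputable def resolutionSnd : Matrix (Fin 5) (Fin 5) KeyRing := genericSkew

/-- Third map of the Pfaffian resolution: the column of signed Pfaffians. -/
noncomputable def resolutionTrd : Matrix (Fin 5) (Fin 1) KeyRing := resolutionFst.transpose

theorem resolutionFst_mul_resolutionSnd : resolutionFst * resolutionSnd = 0 := by
  ext1 i j
  fin_cases j <;>
    simp [Matrix.mul_apply, Fin.sum_univ_five, resolutionFst, resolutionSnd, pfaffian, genericSkew,
      Fin.succAbove] <;> ring

theorem resolutionSnd_mul_resolutionTrd : resolutionSnd * resolutionTrd = 0 := by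
  have hskew : resolutionSnd.transpose = -resolutionSnd := by
    ext1 i j
    fin_cases i <;> fin_cases j <;> simp [resolutionSnd, genericSkew]
  have h := congrArg Matrix.transpose resolutionFst_mul_resolutionSnd
  rw [Matrix.transpose_mul, hskew, Matrix.neg_mul, Matrix.transpose_zero, neg_eq_zero] at h
  exact h

section Pullback

variable {n : ℕ}

/-- The ideal `(y_1, …, y_n)` of the origin of `Spec ℂ[y_1, …, y_n]`. -/
noncomputable def originIdeal (n : ℕ) : Ideal (MvPolynomial (Fin n) ℂ) :=
  Ideal.span (Set.range MvPolynomial.X)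

/-- The ideal of `φ⁻¹(CGr(2,5))`, where the morphism `φ : Spec ℂ[y_1, …, y_n] → ℂ¹⁰` is given by
its pullback homomorphism on coordinate rings. -/
noncomputable def pullbackIdeal (φ : KeyRing →ₐ[ℂ] MvPolynomial (Fin n) ℂ) :
    Ideal (MvPolynomial (Fin n) ℂ) :=
  keyIdeal.map φ

/-- `φ` is graded of degree zero, for the weights `χ` on `ℂ¹⁰` and `W` on `ℂ[y_1, …, y_n]`. -/
def IsGraded (χ : PluckerIndex → ℤ) (W : Fin n → ℕ)
    (φ : KeyRing →ₐ[ℂ] MvPolynomial (Fin n) ℂ) : Prop :=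
  ∀ (p : KeyRing) (k : ℤ), MvPolynomial.IsWeightedHomogeneous χ p k →
    MvPolynomial.IsWeightedHomogeneous (fun i => (W i : ℤ)) (φ p) k

/-- The pullback by `φ` of the Pfaffian resolution is minimal: its maps have all their entries in
the irrelevant ideal, so that (`φ` being graded) no entry is a nonzero constant. -/
def HasMinimalPullback (φ : KeyRing →ₐ[ℂ] MvPolynomial (Fin n) ℂ) : Prop :=
  (∀ i j, φ (resolutionFst i j) ∈ originIdeal n) ∧
  (∀ i j, φ (resolutionSnd i j) ∈ originIdeal n) ∧
  (∀ i j, φ (resolutionTrd i j) ∈ originIdeal n)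

/-- The projectivised pullback `X = (φ⁻¹(CGr(2,5)) \ O) / ℂ^* ⊆ ℙ(W)` is a variety in `CGr(2,5)`
format with key weights `χ`. -/
structure IsInFormat (χ : PluckerIndex → ℤ) (W : Fin n → ℕ)
    (φ : KeyRing →ₐ[ℂ] MvPolynomial (Fin n) ℂ) : Prop where
  isKeyWeight : IsKeyWeight χ
  weight_pos : ∀ i, 0 < W i
  isGraded : IsGraded χ W φ
  /-- The pullback is regular: `φ⁻¹(CGr(2,5))` has the same codimension `3` as `CGr(2,5)`. -/
  codim_eq : (pullbackIdeal φ).height = 3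
  origin_mem : pullbackIdeal φ ≤ originIdeal n
  minimal : HasMinimalPullback φ

/-- `X ⊆ ℙ(W)` is quasismooth: its affine cone `φ⁻¹(CGr(2,5)) = Spec (R ⧸ I)` is nonsingular at
every closed point other than the origin. -/
def IsQuasismooth (φ : KeyRing →ₐ[ℂ] MvPolynomial (Fin n) ℂ) : Prop :=
  ∀ (q : Ideal (MvPolynomial (Fin n) ℂ ⧸ pullbackIdeal φ)) [q.IsMaximal],
    q ≠ (originIdeal n).map (Ideal.Quotient.mk (pullbackIdeal φ)) →
      IsRegularLocalRing (Localization.AtPrime q)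

end Pullback

end GrFormat

/-! If some `χ p ≤ 0`, then `φ (X p)` is homogeneous of non-positive degree without constant term,
hence zero since the weights `W` are positive (`eq_zero_of_isWeightedHomogeneous`). Write `p = (i,
j)` and look where the six entries sharing exactly one index with `p` vanish. All Pfaffians vanish
there, and the three omitting an index other than `i`, `j` vanish to second order, as each of their
monomials contains `x_p` or is a product of two of the six entries. Six equations through the origin
of an affine space of dimension `d + 4 ≥ 7` have another common zero
(`exists_isMaximal_ne_of_ncard_lt_height`). There only two Pfaffians can contribute to the cotangent
space, too few for codimension 3, so the cone is singular (`not_isRegularLocalRing_quotient`). -/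

namespace Ideal

/-! ### Heights and regularity in Noetherian rings -/

variable {R : Type*} [CommRing R]

/-- Heights add up, as an inequality, along a quotient map. -/
theorem height_add_height_le_height_comap_mk [IsNoetherianRing R] (I : Ideal R) (q : Ideal (R ⧸ I))
    [q.IsPrime] : q.height + I.height ≤ (q.comap (Ideal.Quotient.mk I)).height := by
  obtain ⟨l, hlast, hlen⟩ := q.exists_ltSeries_length_eq_height
  -- Pull back a maximal chain of primes below `q`: its bottom contains `I`, and each strict
  -- inclusion raises the height by at least one.
  have key : ∀ (i : ℕ) (hi : i < l.length + 1), i + I.height ≤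
      ((l ⟨i, hi⟩).asIdeal.comap (Ideal.Quotient.mk I)).height := by
    intro i
    induction i with
    | zero =>
      intro hi
      rw [Nat.cast_zero, zero_add]
      refine Ideal.height_mono fun x hx => ?_
      rw [Ideal.mem_comap, Ideal.Quotient.eq_zero_iff_mem.mpr hx]
      exact Ideal.zero_mem _
    | succ i ih =>
      intro hi
      have hlt : (l ⟨i, by lia⟩).asIdeal < (l ⟨i + 1, hi⟩).asIdeal :=
        l.strictMono (Fin.mk_lt_mk.mpr (Nat.lt_succ_self i))
      have hlt' : (l ⟨i, by lia⟩).asIdeal.comap (Ideal.Quotient.mk I) <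
          (l ⟨i + 1, hi⟩).asIdeal.comap (Ideal.Quotient.mk I) :=
        (Ideal.comap_mono hlt.le).lt_of_ne fun h =>
          hlt.ne (Ideal.comap_injective_of_surjective _ Ideal.Quotient.mk_surjective h)
      refine le_trans ?_ (Ideal.height_add_one_le_of_lt_of_isPrime hlt')
      rw [Nat.cast_succ, add_right_comm]
      gcongr
      exact ih _
  have h := key l.length (Nat.lt_succ_self _)
  have hq : (l ⟨l.length, Nat.lt_succ_self _⟩).asIdeal = q :=
    congrArg PrimeSpectrum.asIdeal hlast
  rwa [hq, hlen] at h

/-- If `s` generates `m` modulo `m ^ 2` locally at the prime `m`, then the height of `m` is at most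
the cardinality of `s`. -/
theorem height_le_ncard_of_forall_mul_mem [IsNoetherianRing R] (m : Ideal R) [m.IsPrime]
    (s : Set R) (hs : s.Finite) (hsm : s ⊆ m)
    (h : ∀ x ∈ m, ∃ t ∉ m, t * x ∈ Ideal.span s ⊔ m ^ 2) : m.height ≤ s.ncard := by
  let A := Localization.AtPrime m
  -- Nakayama: `s` generates the maximal ideal modulo its square, hence generates it.
  have hmap : (IsLocalRing.maximalIdeal A) ≤ (Ideal.span s).map (algebraMap R A) := by
    refine Submodule.le_of_le_smul_of_le_jacobson_bot (I := IsLocalRing.maximalIdeal A)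
      (IsNoetherian.noetherian _) (IsLocalRing.maximalIdeal_le_jacobson _) ?_
    rw [← Localization.AtPrime.map_eq_maximalIdeal]
    rw [Ideal.map_le_iff_le_comap]
    intro x hx
    obtain ⟨t, ht, htx⟩ := h x hx
    have h1 := Ideal.mem_map_of_mem (algebraMap R A) htx
    rw [Ideal.map_sup, Ideal.map_pow, map_mul, pow_two] at h1
    exact (Ideal.unit_mul_mem_iff_mem _ (IsLocalization.map_units A (⟨t, ht⟩ : m.primeCompl))).mp h1
  have heq : IsLocalRing.maximalIdeal A = Ideal.span (algebraMap R A '' s) := by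
    rw [← Ideal.map_span]
    refine le_antisymm hmap ?_
    rw [← Localization.AtPrime.map_eq_maximalIdeal]
    exact Ideal.map_mono (Ideal.span_le.mpr hsm)
  have hmin : IsLocalRing.maximalIdeal A ∈ (Ideal.span (algebraMap R A '' s)).minimalPrimes := by
    rw [← heq, Ideal.minimalPrimes_eq_subsingleton_self]
    rfl
  have h2 := Ideal.height_le_card_of_mem_minimalPrimes_span (hs.image _) hmin
  have h3 : (IsLocalRing.maximalIdeal A).height = m.height := by
    have h4 := IsLocalRing.maximalIdeal_height_eq_ringKrullDim (R := A)
    rw [IsLocalization.AtPrime.ringKrullDim_eq_height m A] at h4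
    exact_mod_cast h4
  rw [← h3]
  exact h2.trans (by exact_mod_cast Set.ncard_image_le hs)

/-- The easy direction of the Jacobian criterion: if `I` is generated by fewer than
`height I` elements modulo `m ^ 2`, then `R ⧸ I` is singular at `m`. -/
theorem not_isRegularLocalRing_quotient [IsNoetherianRing R] (I : Ideal R) (q : Ideal (R ⧸ I))
    [q.IsPrime] (s : Set R) (hs : s.Finite) (hsq : s ⊆ q.comap (Ideal.Quotient.mk I))
    (hI : I ≤ Ideal.span s ⊔ (q.comap (Ideal.Quotient.mk I)) ^ 2) (hlt : s.ncard < I.height) :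
    ¬ IsRegularLocalRing (Localization.AtPrime q) := by
  intro hreg
  set m := q.comap (Ideal.Quotient.mk I) with hm
  let S := Localization.AtPrime q
  have hfg : (IsLocalRing.maximalIdeal S).FG := IsNoetherian.noetherian _
  have hdim : ((IsLocalRing.maximalIdeal S).spanFinrank : ℕ∞) = q.height := by
    have h1 := hreg.spanFinrank_maximalIdeal
    rw [IsLocalization.AtPrime.ringKrullDim_eq_height q S] at h1
    exact_mod_cast h1
  set g := (IsLocalRing.maximalIdeal S).generators with hg
  have hgfin : g.Finite := Submodule.FG.finite_generators hfg
  have hgspan : Ideal.span g = IsLocalRing.maximalIdeal S :=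
    (IsLocalRing.maximalIdeal S).span_generators
  -- By regularity `g` has only `q.height` elements; up to units they lift to `m`. With `s` they
  -- generate `m` locally modulo `m ^ 2`, giving `m.height ≤ q.height + s.ncard`.
  have hlift : ∀ x ∈ g, ∃ r ∈ m, ∃ u : q.primeCompl,
      x * algebraMap (R ⧸ I) S u = algebraMap (R ⧸ I) S (Ideal.Quotient.mk I r) := by
    intro x hx
    have hx' : x ∈ q.map (algebraMap _ S) := by
      rw [Localization.AtPrime.map_eq_maximalIdeal, ← hgspan]
      exact Ideal.subset_span hx
    obtain ⟨⟨⟨a, ha⟩, u⟩, h⟩ := (IsLocalization.mem_map_algebraMap_iff q.primeCompl S).mp hx'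
    obtain ⟨r, rfl⟩ := Ideal.Quotient.mk_surjective a
    exact ⟨r, ha, u, h⟩
  choose! r hrm u hru using hlift
  have hle : m.height ≤ (r '' g ∪ s).ncard := by
    refine height_le_ncard_of_forall_mul_mem m _ ((hgfin.image _).union hs) ?_ ?_
    · rintro _ (⟨x, hx, rfl⟩ | hx)
      · exact hrm x hx
      · exact hsq hx
    · intro x hx
      have hx1 : algebraMap _ S (Ideal.Quotient.mk I x) ∈
          ((Ideal.span (r '' g)).map (Ideal.Quotient.mk I)).map (algebraMap _ S) := by
        have hle : IsLocalRing.maximalIdeal S ≤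
            ((Ideal.span (r '' g)).map (Ideal.Quotient.mk I)).map (algebraMap _ S) := by
          rw [← hgspan, Ideal.span_le]
          intro y hy
          refine (Ideal.mul_unit_mem_iff_mem _ (IsLocalization.map_units S (u y))).mp ?_
          rw [hru y hy]
          exact Ideal.mem_map_of_mem _ (Ideal.mem_map_of_mem _ (Ideal.subset_span ⟨y, hy, rfl⟩))
        apply hle
        rw [← Localization.AtPrime.map_eq_maximalIdeal]
        exact Ideal.mem_map_of_mem _ hx
      obtain ⟨t, ht, htx⟩ :=
        (IsLocalization.algebraMap_mem_map_algebraMap_iff q.primeCompl S _ _).mp hx1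
      obtain ⟨t, rfl⟩ := Ideal.Quotient.mk_surjective t
      refine ⟨t, ht, ?_⟩
      rw [← map_mul, ← Ideal.mem_comap, Ideal.comap_map_of_surjective _ Ideal.Quotient.mk_surjective,
        ← RingHom.ker_eq_comap_bot, Ideal.mk_ker] at htx
      rw [Ideal.span_union, sup_assoc]
      exact sup_le_sup_left hI _ htx
  have hcard : (r '' g ∪ s).ncard ≤ (IsLocalRing.maximalIdeal S).spanFinrank + s.ncard := by
    refine (Set.ncard_union_le _ _).trans (Nat.add_le_add_right ?_ _)
    refine (Set.ncard_image_le hgfin).trans (le_of_eq ?_)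
    exact Submodule.FG.generators_ncard hfg
  have h1 : q.height + I.height ≤ q.height + s.ncard := by
    refine (height_add_height_le_height_comap_mk I q).trans (hle.trans ?_)
    rw [← hdim]
    exact_mod_cast hcard
  have h2 : q.height ≠ ⊤ := by
    rw [← hdim]
    exact ENat.natCast_ne_top _
  exact absurd ((ENat.add_le_add_iff_left h2).mp h1) (not_le.mpr hlt)

/-- In a Noetherian Jacobson ring, fewer than `height o` elements of a prime `o` lie in a maximal ideal
other than `o`. -/
theorem exists_isMaximal_ne_of_ncard_lt_height [IsNoetherianRing R] [IsJacobsonRing R]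
    (o : Ideal R) [o.IsPrime] (s : Set R) (hs : s.Finite) (hso : s ⊆ o)
    (hlt : s.ncard < o.height) : ∃ m : Ideal R, m.IsMaximal ∧ Ideal.span s ≤ m ∧ m ≠ o := by
  obtain ⟨p, hp, hpo⟩ := Ideal.exists_minimalPrimes_le (Ideal.span_le.mpr hso)
  have hprime : p.IsPrime := hp.1.1
  by_contra! hcon
  have hpne : p ≠ o := by
    rintro rfl
    exact absurd (Ideal.height_le_card_of_mem_minimalPrimes_span hs hp) (not_le.mpr hlt)
  refine hpne (le_antisymm hpo ?_)
  -- In a Jacobson ring `p` is the intersection of the maximal ideals above it, all equal to `o` by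
  -- `hcon`; but Krull's height theorem excludes `p = o`.
  rw [← IsJacobsonRing.out ‹_› hprime.isRadical, Ideal.jacobson]
  exact le_sInf fun m hm => (hcon m hm.2 (hp.1.2.trans hm.1)).ge

end Ideal

namespace GrFormat

open MvPolynomial

/-! ### The origin of affine space and positive gradings -/

section Origin

variable {n : ℕ}

theorem mem_originIdeal_iff {f : MvPolynomial (Fin n) ℂ} :
    f ∈ originIdeal n ↔ constantCoeff f = 0 := by
  have h := mem_pow_idealOfVars_iff' 1 f
  rw [pow_one] at h
  refine h.trans ⟨fun h => h 0 (by simp), fun h x hx => ?_⟩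
  rw [Nat.lt_one_iff, Finsupp.degree_eq_zero_iff] at hx
  rw [hx]
  exact h

theorem originIdeal_eq_ker : originIdeal n = RingHom.ker (constantCoeff (R := ℂ) (σ := Fin n)) :=
  Ideal.ext fun _ => mem_originIdeal_iff

instance originIdeal_isPrime : (originIdeal n).IsPrime := by
  rw [originIdeal_eq_ker]
  exact RingHom.ker_isPrime _

/-- The substitution setting the first `k` variables to zero. -/
noncomputable def killFirst (n k : ℕ) : MvPolynomial (Fin n) ℂ →ₐ[ℂ] MvPolynomial (Fin n) ℂ :=
  aeval fun i => if (i : ℕ) < k then 0 else X i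

theorem killFirst_comp_of_le {k l : ℕ} (h : k ≤ l) :
    (killFirst n l).comp (killFirst n k) = killFirst n l := by
  ext1 i
  by_cases hi : (i : ℕ) < k
  · simp [killFirst, hi, hi.trans_le h]
  · simp [killFirst, hi]

/-- The kernels form a strictly increasing chain of primes: the variable of index `k` is killed only
at stage `k + 1`. -/
theorem le_height_ker_killFirst (k : ℕ) (hk : k ≤ n) :
    (k : ℕ∞) ≤ (RingHom.ker (killFirst n k)).height := by
  induction k with
  | zero => simp
  | succ k ih =>
    have h1 : RingHom.ker (killFirst n k) < RingHom.ker (killFirst n (k + 1)) := by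
      refine lt_of_le_of_ne (fun f hf => ?_) fun h => ?_
      · rw [RingHom.mem_ker] at hf ⊢
        rw [← killFirst_comp_of_le k.le_succ, AlgHom.comp_apply, hf, map_zero]
      · have h2 : (X ⟨k, hk⟩ : MvPolynomial (Fin n) ℂ) ∈ RingHom.ker (killFirst n (k + 1)) := by
          simp [RingHom.mem_ker, killFirst]
        rw [← h] at h2
        simp [RingHom.mem_ker, killFirst] at h2
    have := RingHom.ker_isPrime (killFirst n k)
    have := RingHom.ker_isPrime (killFirst n (k + 1))
    rw [Nat.cast_succ]
    exact (add_le_add_left (ih (by lia)) 1).trans (Ideal.height_add_one_le_of_lt_of_isPrime h1)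

theorem le_height_originIdeal (n : ℕ) : (n : ℕ∞) ≤ (originIdeal n).height := by
  refine (le_height_ker_killFirst n le_rfl).trans (Ideal.height_mono fun f hf => ?_)
  rw [mem_originIdeal_iff]
  have h : (constantCoeff (R := ℂ) (σ := Fin n)).comp
      (killFirst n n : MvPolynomial (Fin n) ℂ →+* MvPolynomial (Fin n) ℂ) = constantCoeff := by
    ext i <;> simp [killFirst]
  rw [← h, RingHom.comp_apply, AlgHom.coe_toRingHom, RingHom.mem_ker.mp hf, map_zero]

/-- For positive weights, a homogeneous element of non-positive degree is constant. -/
theorem eq_zero_of_isWeightedHomogeneous {W : Fin n → ℕ} (hW : ∀ i, 0 < W i)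
    {f : MvPolynomial (Fin n) ℂ} {k : ℤ} (hk : k ≤ 0)
    (hf : IsWeightedHomogeneous (fun i => (W i : ℤ)) f k) (h0 : f ∈ originIdeal n) : f = 0 := by
  ext x
  rw [coeff_zero]
  by_contra hx
  have hwt := hf hx
  rw [Finsupp.weight_apply, Finsupp.sum_fintype _ _ (by simp)] at hwt
  have hx0 : x = 0 := by
    ext i
    have hnonneg : ∀ j ∈ Finset.univ, 0 ≤ x j • (W j : ℤ) := fun j _ => by positivity
    have h1 := (Finset.single_le_sum hnonneg (Finset.mem_univ i)).trans (hwt.trans_le hk)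
    by_contra hxi
    have h2 : 0 < x i • (W i : ℤ) :=
      nsmul_pos (by exact_mod_cast hW i) hxi
    exact absurd h1 (not_le.mpr h2)
  exact hx (hx0 ▸ mem_originIdeal_iff.mp h0)

end Origin

/-- The coordinates `x_{ij}` whose index pair meets that of `p` in exactly one element. -/
def adjacentIndices (p : PluckerIndex) : Finset PluckerIndex :=
  {q | q ≠ p ∧ (q.1.1 = p.1.1 ∨ q.1.1 = p.1.2 ∨ q.1.2 = p.1.1 ∨ q.1.2 = p.1.2)}

theorem card_adjacentIndices (p : PluckerIndex) : (adjacentIndices p).card = 6 := by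
  revert p
  decide

/-- The two pairs `{a, b}`, `{c, d}` of a monomial of a Pfaffian avoiding the index `m`. -/
def IsSplitting (m a b c d : Fin 5) : Prop :=
  (a, b, c, d) = (m.succAbove 0, m.succAbove 1, m.succAbove 2, m.succAbove 3) ∨
  (a, b, c, d) = (m.succAbove 0, m.succAbove 2, m.succAbove 1, m.succAbove 3) ∨
  (a, b, c, d) = (m.succAbove 0, m.succAbove 3, m.succAbove 1, m.succAbove 2)

/-! ### Order of vanishing of the Pfaffians when `x_p` maps to zero -/

section Vanishing

variable {A : Type*} [CommRing A] (φ : KeyRing →+* A) (p : PluckerIndex)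

/-- The ideal generated by the images of the coordinates adjacent to `p`. -/
noncomputable def adjacentIdeal : Ideal A :=
  Ideal.span ((fun q => φ (X q)) '' (adjacentIndices p : Set PluckerIndex))

variable {φ p}

theorem map_genericSkew_mem (hp : φ (X p) = 0) {a b : Fin 5}
    (h : a = p.1.1 ∨ a = p.1.2 ∨ b = p.1.1 ∨ b = p.1.2) :
    φ (genericSkew a b) ∈ adjacentIdeal φ p := by
  have key : ∀ q : PluckerIndex,
      (q.1.1 = p.1.1 ∨ q.1.1 = p.1.2 ∨ q.1.2 = p.1.1 ∨ q.1.2 = p.1.2) →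
      φ (X q) ∈ adjacentIdeal φ p := by
    intro q hq
    by_cases hqp : q = p
    · rw [hqp, hp]
      exact Ideal.zero_mem _
    · exact Ideal.subset_span ⟨q, by simp [adjacentIndices, hqp, hq], rfl⟩
  unfold genericSkew
  split_ifs with h1 h2
  · exact key ⟨(a, b), h1⟩ h
  · rw [map_neg, neg_mem_iff]
    exact key ⟨(b, a), h2⟩ (by tauto)
  · rw [map_zero]
    exact Ideal.zero_mem _

theorem map_genericSkew_eq_zero (hp : φ (X p) = 0) {a b : Fin 5}
    (h : a = p.1.1 ∧ b = p.1.2 ∨ a = p.1.2 ∧ b = p.1.1) : φ (genericSkew a b) = 0 := by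
  have hlt := p.2
  obtain ⟨rfl, rfl⟩ | ⟨rfl, rfl⟩ := h
  · rw [genericSkew, dif_pos hlt]
    exact hp
  · rw [genericSkew, dif_neg hlt.not_gt, dif_pos hlt, map_neg, neg_eq_zero]
    exact hp

/-- If every monomial of a Pfaffian is mapped into `J`, so is the Pfaffian. -/
theorem map_pfaffian_mem {J : Ideal A} {m : Fin 5}
    (h : ∀ a b c d, IsSplitting m a b c d → φ (genericSkew a b) * φ (genericSkew c d) ∈ J) :
    φ (pfaffian m) ∈ J := by
  simp only [pfaffian, map_add, map_sub, map_mul]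
  exact J.add_mem (J.sub_mem (h _ _ _ _ (Or.inl rfl)) (h _ _ _ _ (Or.inr (Or.inl rfl))))
    (h _ _ _ _ (Or.inr (Or.inr rfl)))

/-- A Pfaffian omits one index, so at least one index of `p` occurs in each of its monomials. -/
theorem map_pfaffian_mem_adjacentIdeal (hp : φ (X p) = 0) (m : Fin 5) :
    φ (pfaffian m) ∈ adjacentIdeal φ p := by
  refine map_pfaffian_mem fun a b c d hs => ?_
  have hcomb : ∀ (p : PluckerIndex) (m a b c d : Fin 5), IsSplitting m a b c d →
      (a = p.1.1 ∨ a = p.1.2 ∨ b = p.1.1 ∨ b = p.1.2) ∨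
      (c = p.1.1 ∨ c = p.1.2 ∨ d = p.1.1 ∨ d = p.1.2) := by
    rintro p m a b c d (h | h | h) <;> simp only [Prod.mk.injEq] at h <;>
      obtain ⟨rfl, rfl, rfl, rfl⟩ := h <;> revert p m <;> decide
  obtain h | h := hcomb p m a b c d hs
  · exact Ideal.mul_mem_right _ _ (map_genericSkew_mem hp h)
  · exact Ideal.mul_mem_left _ _ (map_genericSkew_mem hp h)

/-- Both indices of `p` occur in each monomial: in the same factor, which is then zero, or in
different factors, which then both lie in the ideal. -/
theorem map_pfaffian_mem_adjacentIdeal_sq (hp : φ (X p) = 0) {m : Fin 5} (h1 : m ≠ p.1.1)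
    (h2 : m ≠ p.1.2) : φ (pfaffian m) ∈ adjacentIdeal φ p ^ 2 := by
  refine map_pfaffian_mem fun a b c d hs => ?_
  have hcomb : ∀ (p : PluckerIndex) (m a b c d : Fin 5), m ≠ p.1.1 → m ≠ p.1.2 →
      IsSplitting m a b c d →
      (a = p.1.1 ∧ b = p.1.2 ∨ a = p.1.2 ∧ b = p.1.1) ∨
      (c = p.1.1 ∧ d = p.1.2 ∨ c = p.1.2 ∧ d = p.1.1) ∨
      (a = p.1.1 ∨ a = p.1.2 ∨ b = p.1.1 ∨ b = p.1.2) ∧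
      (c = p.1.1 ∨ c = p.1.2 ∨ d = p.1.1 ∨ d = p.1.2) := by
    rintro p m a b c d h1 h2 (h | h | h) <;> simp only [Prod.mk.injEq] at h <;>
      obtain ⟨rfl, rfl, rfl, rfl⟩ := h <;> revert p m <;> decide
  obtain h | h | ⟨h, h'⟩ := hcomb p m a b c d h1 h2 hs
  · rw [map_genericSkew_eq_zero hp h, zero_mul]
    exact Ideal.zero_mem _
  · rw [map_genericSkew_eq_zero hp h, mul_zero]
    exact Ideal.zero_mem _
  · rw [pow_two]
    exact Ideal.mul_mem_mul (map_genericSkew_mem hp h) (map_genericSkew_mem hp h')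

end Vanishing

/-! ### Singular points of the pulled-back cone -/

section Pullback

variable {n : ℕ} {φ : KeyRing →ₐ[ℂ] MvPolynomial (Fin n) ℂ}

theorem pullbackIdeal_le_iff {J : Ideal (MvPolynomial (Fin n) ℂ)} :
    pullbackIdeal φ ≤ J ↔ ∀ m, φ (pfaffian m) ∈ J := by
  rw [pullbackIdeal, keyIdeal, Ideal.map_span, Ideal.span_le, Set.image_subset_iff,
    Set.range_subset_iff]
  rfl

/-- If a coordinate `x_p` pulls back to zero, the cone is singular along the locus where the six
coordinates adjacent to `p` vanish. -/
theorem not_isQuasismooth_of_map_X_eq_zero (hn : 7 ≤ n) (hcodim : (pullbackIdeal φ).height = 3)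
    (hmin : HasMinimalPullback φ) {p : PluckerIndex} (hp : φ (X p) = 0) : ¬ IsQuasismooth φ := by
  intro hqs
  have hentry : ∀ q : PluckerIndex, φ (X q) ∈ originIdeal n := fun q => by
    have h := hmin.2.1 q.1.1 q.1.2
    rwa [resolutionSnd, genericSkew, dif_pos q.2] at h
  set s := (fun q => φ (X q)) '' (adjacentIndices p : Set PluckerIndex) with hs
  have hsfin : s.Finite := (adjacentIndices p).finite_toSet.image _
  have hscard : s.ncard ≤ 6 := by
    refine (Set.ncard_image_le (adjacentIndices p).finite_toSet).trans ?_
    rw [Set.ncard_coe_finset, card_adjacentIndices]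
  have hso : s ⊆ originIdeal n := by
    rintro _ ⟨q, -, rfl⟩
    exact hentry q
  have hlt : (s.ncard : ℕ∞) < (originIdeal n).height :=
    lt_of_lt_of_le (by exact_mod_cast (show s.ncard < n by lia)) (le_height_originIdeal n)
  obtain ⟨m, hm, hsm, hmo⟩ := Ideal.exists_isMaximal_ne_of_ncard_lt_height _ s hsfin hso hlt
  have hp' : (φ : KeyRing →+* MvPolynomial (Fin n) ℂ) (X p) = 0 := hp
  have hJm : adjacentIdeal (φ : KeyRing →+* MvPolynomial (Fin n) ℂ) p ≤ m := hsm
  have hIm : pullbackIdeal φ ≤ m :=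
    pullbackIdeal_le_iff.mpr fun k => hJm (map_pfaffian_mem_adjacentIdeal hp' k)
  have hIo : pullbackIdeal φ ≤ originIdeal n := by
    refine pullbackIdeal_le_iff.mpr fun k => ?_
    exact (Ideal.span_le.mpr hso) (map_pfaffian_mem_adjacentIdeal hp' k)
  set q := m.map (Ideal.Quotient.mk (pullbackIdeal φ)) with hq
  have hcomap : q.comap (Ideal.Quotient.mk (pullbackIdeal φ)) = m := Ideal.comap_map_mk hIm
  have hqmax : q.IsMaximal := by
    refine (Ideal.map_eq_top_or_isMaximal_of_surjective _ Ideal.Quotient.mk_surjective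
      hm).resolve_left fun h => hm.ne_top ?_
    rw [← hcomap, hq, h, Ideal.comap_top]
  have hqo : q ≠ (originIdeal n).map (Ideal.Quotient.mk (pullbackIdeal φ)) := by
    intro h
    rw [h, Ideal.comap_map_mk hIo] at hcomap
    exact hmo hcomap.symm
  -- Modulo `m ^ 2` only the two Pfaffians omitting an index of `p` survive, against height 3.
  refine Ideal.not_isRegularLocalRing_quotient (pullbackIdeal φ) q
    {φ (pfaffian p.1.1), φ (pfaffian p.1.2)} (Set.toFinite _) ?_ ?_ ?_ (hqs q hqo)
  · rw [hcomap]
    rintro _ (rfl | rfl)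
    · exact pullbackIdeal_le_iff.mp hIm _
    · exact pullbackIdeal_le_iff.mp hIm _
  · rw [hcomap, pullbackIdeal_le_iff]
    intro k
    by_cases h1 : k = p.1.1
    · exact Ideal.mem_sup_left (Ideal.subset_span (by simp [h1]))
    by_cases h2 : k = p.1.2
    · exact Ideal.mem_sup_left (Ideal.subset_span (by simp [h2]))
    exact Ideal.mem_sup_right
      (Ideal.pow_right_mono hJm 2 (map_pfaffian_mem_adjacentIdeal_sq hp' h1 h2))
  · rw [hcodim]
    refine lt_of_le_of_lt (b := ((2 : ℕ) : ℕ∞)) ?_ (by norm_num)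
    exact_mod_cast (Set.ncard_insert_le _ _).trans (by rw [Set.ncard_singleton])

end Pullback

end GrFormat

theorem proposition2p4 (d : ℕ) (hd : 3 ≤ d)
    (χ : GrFormat.PluckerIndex → ℤ)
    (W : Fin (d + 4) → ℕ)
    (φ : GrFormat.KeyRing →ₐ[ℂ] MvPolynomial (Fin (d + 4)) ℂ)
    (hX : GrFormat.IsInFormat χ W φ)
    (hqs : GrFormat.IsQuasismooth φ) :
    ∀ p : GrFormat.PluckerIndex, 0 < χ p := by
  intro p
  by_contra! hp
  -- The bound `7 ≤ d + 4` is where `3 ≤ d` enters.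
  refine GrFormat.not_isQuasismooth_of_map_X_eq_zero (p := p) (by lia) hX.codim_eq hX.minimal ?_ hqs
  have hmem := hX.minimal.2.1 p.1.1 p.1.2
  rw [GrFormat.resolutionSnd, GrFormat.genericSkew, dif_pos p.2] at hmem
  exact GrFormat.eq_zero_of_isWeightedHomogeneous hX.weight_pos hp
    (hX.isGraded _ _ (MvPolynomial.isWeightedHomogeneous_X ℂ χ p)) hmem
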